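/- Let $X$ be a complex Banach space and $T$ a bounded linear operator on $X$, with dual operator $T^*$ on $X^*$. Conventions. For a bounded operator $S$ on a Banach space put $\alpha(S)=\dim\ker S$ and $\beta(S)=\operatorname{codim}\operatorname{ran}S$, and let the ascent $p(S)$ (resp. descent $q(S)$) be the least $n\ge 0$ with $\ker S^n=\ker S^{n+1}$ (resp. $\operatorname{ran}S^n=\operatorname{ran}S^{n+1}$), or $\infty$ if there is none. $S$ is upper semi-Fredholm if $\alpha(S)<\infty$ and $\operatorname{ran}S$ is closed, lower semi-Fredholm if $\beta(S)<\infty$, semi-Fredholm if it is one of the two, and Fredholm if it is both; the index of a semi-Fredholm operator is $\operatorname{ind}(S)=\alpha(S)-\beta(S)\in\mathbb Z\cup\{\pm\infty\}$. $S$ is upper semi-Browder if it is upper semi-Fredholm with $p(S)<\infty$, lower semi-Browder if it is lower semi-Fredholm with $q(S)<\infty$, and Browder if it is Fredholm with $p(S)<\infty$ and $q(S)<\infty$. $S$ is zeroloid if its spectrum has no accumulation point other than possibly $0$. $S$ has the SVEP at $0$ if, for every connected open neighbourhood $U$ of $0$, the only analytic function $f$ on $U$ with $(S-\mu I)f(\mu)=0$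 for all $\mu\in U$ is $f=0$. $T$ is upper semi-$g_z$-Fredholm (resp. lower semi-$g_z$-Fredholm, $g_z$-Fredholm, upper semi-$g_z$-Browder, lower semi-$g_z$-Browder, $g_z$-Browder) if there are closed $T$-invariant subspaces $M,N$ with $X=M\oplus N$ such that the restriction $T_M$ is upper semi-Fredholm (resp. lower semi-Fredholm, Fredholm, upper semi-Browder, lower semi-Browder, Browder) and the restriction $T_N$ is zeroloid. If $T$ is upper or lower semi-$g_z$-Fredholm, its index $\operatorname{ind}(T)$ is $\operatorname{ind}(T_M)$ for any such pair $(M,N)$ with $T_M$ semi-Fredholm and $T_N$ zeroloid (it does not depend on the pair). $T$ is upper semi-$g_z$-Weyl (resp. lower semi-$g_z$-Weyl, $g_z$-Weyl) if it is upper semi-$g_z$-Fredholm with $\operatorname{ind}(T)\le 0$ (resp. lower semi-$g_z$-Fredholm with $\operatorname{ind}(T)\ge 0$, $g_z$-Fredholm with $\operatorname{ind}(T)=0$). Proposition. (1) The following are equivalent: (i) $T$ is upper semi-$g_z$-Browder; (ii) $T$ is upper semi-$g_z$-Weyl and $T$ has the SVEP at $0$; (iii) $T$ is upper semi-$g_z$-Fredholm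 and $T$ has the SVEP at $0$. (2) The following are equivalent: (i) $T$ is lower semi-$g_z$-Browder; (ii) $T$ is lower semi-$g_z$-Weyl and $T^*$ has the SVEP at $0$; (iii) $T$ is lower semi-$g_z$-Fredholm and $T^*$ has the SVEP at $0$. (3) The following are equivalent: (i) $T$ is $g_z$-Browder; (ii) $T$ is $g_z$-Weyl and $T$ or $T^*$ has the SVEP at $0$; (iii) $T$ is $g_z$-Fredholm and $T\oplus T^*$ has the SVEP at $0$. -/

import Mathlib

open Topology

noncomputable section

namespace GzTheory

section Basic

variable {Y : Type*} [NormedAddCommGroup Y] [NormedSpace ℂ Y]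

/-- `α(T)`: the dimension of the kernel of `T`, as an extended natural number. -/
def nullity (T : Y →L[ℂ] Y) : ℕ∞ := Cardinal.toENat (Module.rank ℂ T.ker)

/-- `β(T)`: the codimension of the range of `T`, as an extended natural number. -/
def deficiency (T : Y →L[ℂ] Y) : ℕ∞ := Cardinal.toENat (Module.rank ℂ (Y ⧸ T.range))

/-- `p(T)`: the least `n` with `ker Tⁿ = ker Tⁿ⁺¹`, and `∞` if there is none. -/
def ascent (T : Y →L[ℂ] Y) : ℕ∞ :=
  sInf ((fun n : ℕ => (n : ℕ∞)) '' {n : ℕ | (T ^ n).ker = (T ^ (n + 1)).ker})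

/-- `q(T)`: the least `n` with `range Tⁿ = range Tⁿ⁺¹`, and `∞` if there is none. -/
def descent (T : Y →L[ℂ] Y) : ℕ∞ :=
  sInf ((fun n : ℕ => (n : ℕ∞)) '' {n : ℕ | (T ^ n).range = (T ^ (n + 1)).range})

/-- Upper semi-Fredholm: finite-dimensional kernel and closed range. -/
def IsUpperSemiFredholm (T : Y →L[ℂ] Y) : Prop :=
  nullity T < ⊤ ∧ IsClosed (T.range : Set Y)

/-- Lower semi-Fredholm: range of finite codimension (on a Banach space the range is then
automatically closed). -/
def IsLowerSemiFredholm (T : Y →L[ℂ] Y) : Prop :=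
  deficiency T < ⊤

/-- Semi-Fredholm: upper or lower semi-Fredholm. -/
def IsSemiFredholm (T : Y →L[ℂ] Y) : Prop :=
  IsUpperSemiFredholm T ∨ IsLowerSemiFredholm T

/-- The index `α(T) - β(T)` of a semi-Fredholm operator, an integer or `±∞`. It is only used for
semi-Fredholm operators, for which the difference is not of the form `∞ - ∞`. -/
def index (T : Y →L[ℂ] Y) : EReal :=
  (((nullity T : ℕ∞) : ENNReal) : EReal) - (((deficiency T : ℕ∞) : ENNReal) : EReal)

/-- Upper semi-Browder: upper semi-Fredholm with finite ascent. -/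
def IsUpperSemiBrowder (T : Y →L[ℂ] Y) : Prop :=
  IsUpperSemiFredholm T ∧ ascent T < ⊤

/-- Lower semi-Browder: lower semi-Fredholm with finite descent. -/
def IsLowerSemiBrowder (T : Y →L[ℂ] Y) : Prop :=
  IsLowerSemiFredholm T ∧ descent T < ⊤

/-- Browder: Fredholm with finite ascent and finite descent. -/
def IsBrowder (T : Y →L[ℂ] Y) : Prop :=
  T.IsFredholm ∧ ascent T < ⊤ ∧ descent T < ⊤

/-- Zeroloid: the spectrum has no accumulation point other than (possibly) `0`. -/
def IsZeroloid (T : Y →L[ℂ] Y) : Prop :=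
  derivedSet (spectrum ℂ T) ⊆ {0}

/-- The single-valued extension property of `T` at `z`: on every connected open neighbourhood `U`
of `z`, the only analytic solution `f : U → Y` of `(T - μ I) f(μ) = 0` is `f = 0`. -/
def HasSVEPAt (T : Y →L[ℂ] Y) (z : ℂ) : Prop :=
  ∀ U : Set ℂ, IsOpen U → IsPreconnected U → z ∈ U →
    ∀ f : ℂ → Y, AnalyticOnNhd ℂ f U →
      (∀ μ ∈ U, (T - μ • ContinuousLinearMap.id ℂ Y) (f μ) = 0) → ∀ μ ∈ U, f μ = 0

/-- The dual operator `T* : Y* → Y*`, `φ ↦ φ ∘ T`, on the (Banach) dual of `Y`. -/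
def dualOp (T : Y →L[ℂ] Y) : StrongDual ℂ Y →L[ℂ] StrongDual ℂ Y :=
  ContinuousLinearMap.precomp ℂ T

theorem nullity_lt_top_iff (T : Y →L[ℂ] Y) : nullity T < ⊤ ↔ FiniteDimensional ℂ T.ker := by
  rw [nullity, Cardinal.toENat_lt_top, Module.rank_lt_aleph0_iff]

theorem deficiency_lt_top_iff (T : Y →L[ℂ] Y) :
    deficiency T < ⊤ ↔ FiniteDimensional ℂ (Y ⧸ T.range) := by
  rw [deficiency, Cardinal.toENat_lt_top, Module.rank_lt_aleph0_iff]

/-- On a Banach space, Fredholm means upper and lower semi-Fredholm. -/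
theorem isFredholm_iff [CompleteSpace Y] (T : Y →L[ℂ] Y) :
    T.IsFredholm ↔ IsUpperSemiFredholm T ∧ IsLowerSemiFredholm T := by
  rw [IsUpperSemiFredholm, IsLowerSemiFredholm, nullity_lt_top_iff, deficiency_lt_top_iff]
  constructor
  · intro h
    exact ⟨⟨h.finite_ker, h.isClosed_range⟩, h.finite_coker⟩
  · rintro ⟨⟨h1, h2⟩, h3⟩
    refine ⟨?_, h2, h1, h3, Submodule.ClosedComplemented.of_finiteDimensional _⟩
    have : CompleteSpace T.range := h2.completeSpace_coe
    have ho : IsOpenMap T.rangeRestrict :=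
      T.rangeRestrict.isOpenMap (LinearMap.surjective_rangeRestrict T.toLinearMap)
    have hq : IsQuotientMap (Set.rangeFactorization T) :=
      ho.isQuotientMap T.rangeRestrict.continuous
        (LinearMap.surjective_rangeRestrict T.toLinearMap)
    exact Topology.isStrictMap_iff_isQuotientMap_rangeFactorization.2 hq

end Basic

section Reduction

variable {X : Type*} [NormedAddCommGroup X] [NormedSpace ℂ X]

/-- `(M, N) ∈ Red(T)`: closed `T`-invariant subspaces `M`, `N` with `X = M ⊕ N`. -/
structure Red (T : X →L[ℂ] X) where
  M : Submodule ℂ X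
  N : Submodule ℂ X
  isClosed_M : IsClosed (M : Set X)
  isClosed_N : IsClosed (N : Set X)
  invariant_M : ∀ x ∈ M, T x ∈ M
  invariant_N : ∀ x ∈ N, T x ∈ N
  isCompl : IsCompl M N

/-- The restriction `T_M : M → M`. -/
def Red.onM {T : X →L[ℂ] X} (D : Red T) : D.M →L[ℂ] D.M := T.restrict D.invariant_M

/-- The restriction `T_N : N → N`. -/
def Red.onN {T : X →L[ℂ] X} (D : Red T) : D.N →L[ℂ] D.N := T.restrict D.invariant_N

/-- Upper semi-`g_z`-Fredholm. -/
def IsUpperSemiGzFredholm (T : X →L[ℂ] X) : Prop :=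
  ∃ D : Red T, IsUpperSemiFredholm D.onM ∧ IsZeroloid D.onN

/-- Lower semi-`g_z`-Fredholm. -/
def IsLowerSemiGzFredholm (T : X →L[ℂ] X) : Prop :=
  ∃ D : Red T, IsLowerSemiFredholm D.onM ∧ IsZeroloid D.onN

/-- `g_z`-Fredholm. -/
def IsGzFredholm (T : X →L[ℂ] X) : Prop :=
  ∃ D : Red T, D.onM.IsFredholm ∧ IsZeroloid D.onN

open Classical in
/-- The index of a semi-`g_z`-Fredholm operator `T`: the index of `T_M` for any `(M, N) ∈ Red(T)`
with `T_M` semi-Fredholm and `T_N` zeroloid (it does not depend on the pair; one is chosen here).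
The value `0` for other operators is never used. -/
def gzIndex (T : X →L[ℂ] X) : EReal :=
  if h : ∃ D : Red T, IsSemiFredholm D.onM ∧ IsZeroloid D.onN then index h.choose.onM else 0

/-- Upper semi-`g_z`-Weyl. -/
def IsUpperSemiGzWeyl (T : X →L[ℂ] X) : Prop :=
  IsUpperSemiGzFredholm T ∧ gzIndex T ≤ 0

/-- Lower semi-`g_z`-Weyl. -/
def IsLowerSemiGzWeyl (T : X →L[ℂ] X) : Prop :=
  IsLowerSemiGzFredholm T ∧ 0 ≤ gzIndex T

/-- `g_z`-Weyl. -/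
def IsGzWeyl (T : X →L[ℂ] X) : Prop :=
  IsGzFredholm T ∧ gzIndex T = 0

/-- Upper semi-`g_z`-Browder: direct sum of an upper semi-Browder and a zeroloid operator. -/
def IsUpperSemiGzBrowder (T : X →L[ℂ] X) : Prop :=
  ∃ D : Red T, IsUpperSemiBrowder D.onM ∧ IsZeroloid D.onN

/-- Lower semi-`g_z`-Browder: direct sum of a lower semi-Browder and a zeroloid operator. -/
def IsLowerSemiGzBrowder (T : X →L[ℂ] X) : Prop :=
  ∃ D : Red T, IsLowerSemiBrowder D.onM ∧ IsZeroloid D.onN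

/-- `g_z`-Browder: direct sum of a Browder and a zeroloid operator. -/
def IsGzBrowder (T : X →L[ℂ] X) : Prop :=
  ∃ D : Red T, IsBrowder D.onM ∧ IsZeroloid D.onN

end Reduction

end GzTheory

end

open Topology

noncomputable section

namespace GzTheory

/-! ### Kernels and ranges of powers. -/

section Algebra

variable {Y : Type*} [NormedAddCommGroup Y] [NormedSpace ℂ Y]

/-! The zeroloid summand is harmless: `T_N - μ` is invertible for `μ` near some nonzero point of any
neighbourhood of `0`, so `T_N` and its dual have the SVEP at `0`. Hence, for `X = M ⊕ N`, the SVEP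
of `T` or `T*` is that of `S = T_M` or `S*`. What remains is that a semi-Fredholm `S` has finite
ascent iff `S` has the SVEP at `0`, and finite descent iff `S*` has it.

Finite ascent gives the SVEP because the leading coefficient of a nonzero local solution lies in
`ker S ∩ ran Sⁿ` for every `n` (`hasSVEPAt_zero_of_ascent_lt_top`). Conversely, all `ran Sⁿ` are
closed and `ker S ∩ ran Sⁿ` stabilizes, so `S` maps `⋂ ran Sⁿ` onto itself; a nonzero kernel vector
there would start a backward orbit whose power series violates the SVEP
(`HasSVEPAt.disjoint_ker_of_surjOn`). Descent is handled by duality.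

For the index, put `K = ker Sⁿ` and compare `K / S K` with `Y / ran S`: the natural map is injective
when the ascent is at most `n` and surjective when the descent is. This gives `α ≤ β` or `β ≤ α`
respectively, and at index zero either finiteness yields the other. These signs hold for every
admissible pair `(M, N)`, so independence of the index from the pair is never needed. -/

theorem pow_succ_apply (S : Y →L[ℂ] Y) (n : ℕ) (x : Y) : (S ^ (n + 1)) x = (S ^ n) (S x) := by
  rw [pow_succ]; rfl

theorem pow_succ_apply' (S : Y →L[ℂ] Y) (n : ℕ) (x : Y) : (S ^ (n + 1)) x = S ((S ^ n) x) := by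
  rw [pow_succ']; rfl

theorem ascent_lt_top_iff (S : Y →L[ℂ] Y) :
    ascent S < ⊤ ↔ ∃ n, (S ^ n).ker = (S ^ (n + 1)).ker := by
  rw [ascent, sInf_lt_iff]
  simp

theorem descent_lt_top_iff (S : Y →L[ℂ] Y) :
    descent S < ⊤ ↔ ∃ n, (S ^ n).range = (S ^ (n + 1)).range := by
  rw [descent, sInf_lt_iff]
  simp

theorem ker_pow_le_succ (S : Y →L[ℂ] Y) (n : ℕ) : (S ^ n).ker ≤ (S ^ (n + 1)).ker := by
  intro x hx
  have hx : (S ^ n) x = 0 := hx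
  change (S ^ (n + 1)) x = 0
  rw [pow_succ_apply', hx, map_zero]

theorem range_pow_succ_le (S : Y →L[ℂ] Y) (n : ℕ) : (S ^ (n + 1)).range ≤ (S ^ n).range := by
  rintro _ ⟨x, rfl⟩
  exact ⟨S x, (pow_succ_apply S n x).symm⟩

theorem antitone_range_pow (S : Y →L[ℂ] Y) : Antitone fun n : ℕ => (S ^ n).range :=
  antitone_nat_of_succ_le (range_pow_succ_le S)

theorem monotone_ker_pow (S : Y →L[ℂ] Y) : Monotone fun n : ℕ => (S ^ n).ker :=
  monotone_nat_of_le_succ (ker_pow_le_succ S)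

theorem ker_pow_eq_succ_of_disjoint {S : Y →L[ℂ] Y} {n : ℕ}
    (h : Disjoint S.ker (S ^ n).range) : (S ^ n).ker = (S ^ (n + 1)).ker := by
  refine le_antisymm (ker_pow_le_succ S n) fun x hx => ?_
  have hx : (S ^ (n + 1)) x = 0 := hx
  rw [pow_succ_apply'] at hx
  exact Submodule.disjoint_def.1 h _ hx ⟨x, rfl⟩

theorem disjoint_ker_range_pow {S : Y →L[ℂ] Y} {n : ℕ} (h : (S ^ n).ker = (S ^ (n + 1)).ker) :
    Disjoint S.ker (S ^ n).range := by
  rw [Submodule.disjoint_def]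
  rintro _ hx ⟨y, rfl⟩
  have : (S ^ (n + 1)) y = 0 := by rw [pow_succ_apply']; exact hx
  have : y ∈ (S ^ n).ker := h ▸ this
  exact this

theorem ker_pow_sup_range_eq_top {S : Y →L[ℂ] Y} {n : ℕ}
    (h : (S ^ n).range = (S ^ (n + 1)).range) : (S ^ n).ker ⊔ S.range = ⊤ := by
  rw [eq_top_iff]
  rintro x -
  have : (S ^ n) x ∈ (S ^ (n + 1)).range := h ▸ ⟨x, rfl⟩
  obtain ⟨y, hy⟩ := this
  have hy : (S ^ (n + 1)) y = (S ^ n) x := hy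
  have : x - S y ∈ (S ^ n).ker := by
    change (S ^ n) (x - S y) = 0
    rw [map_sub, ← pow_succ_apply, hy, sub_self]
  rw [← sub_add_cancel x (S y)]
  exact Submodule.add_mem_sup this ⟨y, rfl⟩

theorem range_pow_eq_succ_of_sup_eq_top {S : Y →L[ℂ] Y} {n : ℕ}
    (h : (S ^ n).ker ⊔ S.range = ⊤) : (S ^ n).range = (S ^ (n + 1)).range := by
  refine le_antisymm ?_ (range_pow_succ_le S n)
  rintro _ ⟨x, rfl⟩
  obtain ⟨u, hu, _, ⟨y, rfl⟩, rfl⟩ := Submodule.mem_sup.1 (h ▸ Submodule.mem_top : x ∈ _)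
  refine ⟨y, ?_⟩
  have hu : (S ^ n) u = 0 := hu
  change (S ^ (n + 1)) y = (S ^ n) (u + S y)
  rw [map_add, hu, zero_add, pow_succ_apply]

/-- `ker S ∩ ran Sⁿ` is constant at step `n` exactly when `ker Sⁿ + ran S` is. -/
theorem ker_inf_range_pow_le_succ_iff (S : Y →L[ℂ] Y) (n : ℕ) :
    S.ker ⊓ (S ^ n).range ≤ (S ^ (n + 1)).range ↔
      (S ^ (n + 1)).ker ≤ (S ^ n).ker ⊔ S.range := by
  constructor
  · intro h x hx
    have hx : (S ^ (n + 1)) x = 0 := hx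
    rw [pow_succ_apply'] at hx
    obtain ⟨y, hy⟩ := h ⟨hx, ⟨x, rfl⟩⟩
    have hy : (S ^ (n + 1)) y = (S ^ n) x := hy
    have : x - S y ∈ (S ^ n).ker := by
      change (S ^ n) (x - S y) = 0
      rw [map_sub, ← pow_succ_apply, hy, sub_self]
    rw [← sub_add_cancel x (S y)]
    exact Submodule.add_mem_sup this ⟨y, rfl⟩
  · rintro h _ ⟨hx, ⟨x, rfl⟩⟩
    have : x ∈ (S ^ (n + 1)).ker := by
      change (S ^ (n + 1)) x = 0
      rw [pow_succ_apply']; exact hx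
    obtain ⟨u, hu, _, ⟨y, rfl⟩, rfl⟩ := Submodule.mem_sup.1 (h this)
    refine ⟨y, ?_⟩
    have hu : (S ^ n) u = 0 := hu
    change (S ^ (n + 1)) y = (S ^ n) (u + S y)
    rw [map_add, hu, zero_add, pow_succ_apply]

end Algebra

/-! ### The SVEP at `0`: transfer, zeroloid operators, ascent. -/

section SVEP

variable {Y Z : Type*} [NormedAddCommGroup Y] [NormedSpace ℂ Y]
  [NormedAddCommGroup Z] [NormedSpace ℂ Z]

/-- An intertwiner carries local solutions to local solutions. It is applied to the inclusion of `M`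
in `X` and to the embedding of `M*` in `X*`. -/
theorem HasSVEPAt.of_injective {S : Y →L[ℂ] Y} {T : Z →L[ℂ] Z} {z : ℂ} (hT : HasSVEPAt T z)
    (J : Y →L[ℂ] Z) (hJ : Function.Injective J) (h : ∀ y, J (S y) = T (J y)) :
    HasSVEPAt S z := by
  intro U hU hUc hz f hf hfU μ hμ
  refine hJ ?_
  rw [map_zero]
  refine hT U hU hUc hz (fun w => J (f w)) (J.comp_analyticOnNhd hf) (fun w hw => ?_) μ hμ
  have := congrArg J (hfU w hw)
  simpa [h] using this

theorem HasSVEPAt.of_jointly_injective {Y₁ Y₂ : Type*} [NormedAddCommGroup Y₁] [NormedSpace ℂ Y₁]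
    [NormedAddCommGroup Y₂] [NormedSpace ℂ Y₂] {S₁ : Y₁ →L[ℂ] Y₁} {S₂ : Y₂ →L[ℂ] Y₂}
    {T : Z →L[ℂ] Z} {z : ℂ} (h₁ : HasSVEPAt S₁ z) (h₂ : HasSVEPAt S₂ z)
    (A : Z →L[ℂ] Y₁) (B : Z →L[ℂ] Y₂) (hA : ∀ x, A (T x) = S₁ (A x))
    (hB : ∀ x, B (T x) = S₂ (B x)) (hAB : ∀ x, A x = 0 → B x = 0 → x = 0) :
    HasSVEPAt T z := by
  intro U hU hUc hz f hf hfU μ hμ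
  refine hAB _ ?_ ?_
  · refine h₁ U hU hUc hz (fun w => A (f w)) (A.comp_analyticOnNhd hf) (fun w hw => ?_) μ hμ
    have := congrArg A (hfU w hw)
    simpa [hA] using this
  · refine h₂ U hU hUc hz (fun w => B (f w)) (B.comp_analyticOnNhd hf) (fun w hw => ?_) μ hμ
    have := congrArg B (hfU w hw)
    simpa [hB] using this

theorem hasSVEPAt_prodMap_iff {S : Y →L[ℂ] Y} {T : Z →L[ℂ] Z} {z : ℂ} :
    HasSVEPAt (S.prodMap T) z ↔ HasSVEPAt S z ∧ HasSVEPAt T z := by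
  constructor
  · intro h
    refine ⟨h.of_injective (ContinuousLinearMap.inl ℂ Y Z) (fun a b hab => ?_) (fun y => ?_),
      h.of_injective (ContinuousLinearMap.inr ℂ Y Z) (fun a b hab => ?_) (fun y => ?_)⟩
    · simpa using hab
    · simp
    · simpa using hab
    · simp
  · rintro ⟨h₁, h₂⟩
    refine h₁.of_jointly_injective h₂ (ContinuousLinearMap.fst ℂ Y Z)
      (ContinuousLinearMap.snd ℂ Y Z) (fun x => rfl) (fun x => rfl) (fun x hx hy => ?_)
    exact Prod.ext hx hy

/-- If `S - μ` is injective for all `μ` outside a set that accumulates at most at `0`, then `S` has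
the SVEP at `0`. -/
theorem hasSVEPAt_zero_of_derivedSet_subset {S : Y →L[ℂ] Y} {σ : Set ℂ}
    (hσ : derivedSet σ ⊆ {0})
    (h : ∀ μ ∉ σ, ∀ y, (S - μ • ContinuousLinearMap.id ℂ Y) y = 0 → y = 0) :
    HasSVEPAt S 0 := by
  intro U hU hUc h0 f hf hfU μ hμ
  -- The set `σ` may accumulate at `0` itself, so the identity theorem is applied at another point
  -- of `U`.
  obtain ⟨w, hwU, hw0⟩ : ∃ w ∈ U, w ≠ 0 := by
    have : ∀ᶠ w in 𝓝[≠] (0 : ℂ), w ∈ U := mem_nhdsWithin_of_mem_nhds (hU.mem_nhds h0)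
    obtain ⟨w, hw, hw'⟩ := (this.and self_mem_nhdsWithin).exists
    exact ⟨w, hw, hw'⟩
  have hacc : ¬ AccPt w (Filter.principal σ) := fun hw => hw0 (hσ hw)
  rw [accPt_iff_frequently_nhdsNE, Filter.not_frequently] at hacc
  refine hf.eqOn_zero_of_preconnected_of_frequently_eq_zero hUc hwU ?_ hμ
  refine Filter.Eventually.frequently ?_
  filter_upwards [hacc, mem_nhdsWithin_of_mem_nhds (hU.mem_nhds hwU)] with v hv hvU
  exact h v hv _ (hfU v hvU)

theorem IsZeroloid.hasSVEPAt {S : Y →L[ℂ] Y} (hS : IsZeroloid S) : HasSVEPAt S 0 := by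
  refine hasSVEPAt_zero_of_derivedSet_subset hS fun μ hμ y hy => ?_
  obtain ⟨u, hu⟩ := spectrum.notMem_iff.1 hμ
  have hy' : (u : Y →L[ℂ] Y) y = 0 := by
    rw [hu]
    have : algebraMap ℂ (Y →L[ℂ] Y) μ - S = -(S - μ • ContinuousLinearMap.id ℂ Y) := by
      rw [neg_sub, Algebra.algebraMap_eq_smul_one]; rfl
    rw [this, neg_apply, hy, neg_zero]
  have : (((u⁻¹ : (Y →L[ℂ] Y)ˣ) : Y →L[ℂ] Y) * u) y = 0 := by
    rw [mul_apply_eq_comp, hy', map_zero]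
  rwa [Units.inv_mul] at this

/-- The spectrum of the dual is not needed: off `σ(S)` the operator `S - μ` is onto, so a functional
vanishing on its range is zero. -/
theorem IsZeroloid.hasSVEPAt_dualOp {S : Y →L[ℂ] Y} (hS : IsZeroloid S) :
    HasSVEPAt (dualOp S) 0 := by
  refine hasSVEPAt_zero_of_derivedSet_subset hS fun μ hμ φ hφ => ?_
  obtain ⟨u, hu⟩ := spectrum.notMem_iff.1 hμ
  ext y
  have h1 : (u : Y →L[ℂ] Y) (((u⁻¹ : (Y →L[ℂ] Y)ˣ) : Y →L[ℂ] Y) y) = y := by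
    rw [← mul_apply_eq_comp, Units.mul_inv]; rfl
  set x := ((u⁻¹ : (Y →L[ℂ] Y)ˣ) : Y →L[ℂ] Y) y
  have h2 : φ (S x) - μ * φ x = 0 := by simpa [dualOp] using congrArg (fun ψ => ψ x) hφ
  rw [← h1, hu]
  have h3 : (algebraMap ℂ (Y →L[ℂ] Y) μ - S) x = μ • x - S x := by
    rw [Algebra.algebraMap_eq_smul_one]; rfl
  rw [h3, map_sub, map_smul, smul_eq_mul, ← neg_sub, h2]
  simp

/-- Analytic local solutions of `S g = μ g` take values in every range `ran Sⁿ` at `0`. -/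
theorem exists_analyticAt_pow_apply_eq {S : Y →L[ℂ] Y} {g : ℂ → Y} (hg : AnalyticAt ℂ g 0)
    (h : ∀ᶠ μ in 𝓝 (0 : ℂ), S (g μ) = μ • g μ) (n : ℕ) :
    ∃ k : ℂ → Y, AnalyticAt ℂ k 0 ∧ ∀ᶠ μ in 𝓝 (0 : ℂ), (S ^ n) (k μ) = g μ := by
  have hds : ∀ k : ℂ → Y, AnalyticAt ℂ k 0 → AnalyticAt ℂ (dslope k 0) 0 := by
    rintro k ⟨p, hp⟩
    exact ⟨_, hp.has_fpower_series_dslope_fslope⟩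
  -- Since `S (g 0) = 0`, applying `S` to `(g μ - g 0) / μ` gives `g μ`; continuity covers `μ = 0`.
  have key : ∀ᶠ μ in 𝓝 (0 : ℂ), S (dslope g 0 μ) = g μ := by
    have hc1 : ContinuousAt (fun μ => S (dslope g 0 μ)) 0 :=
      S.continuous.continuousAt.comp (hds g hg).continuousAt
    have hne : ∀ᶠ μ in 𝓝[≠] (0 : ℂ), S (dslope g 0 μ) = g μ := by
      filter_upwards [mem_nhdsWithin_of_mem_nhds h, self_mem_nhdsWithin] with μ hμ hμ0
      have h0 : S (g 0) = 0 := by simpa using h.self_of_nhds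
      have hμ : S (g μ) = μ • g μ := hμ
      have hμ0 : μ ≠ 0 := hμ0
      rw [dslope_of_ne _ hμ0, slope_def_module, sub_zero, map_smul, map_sub, h0, hμ, sub_zero,
        smul_smul, inv_mul_cancel₀ hμ0, one_smul]
    have h00 : S (dslope g 0 0) = g 0 :=
      tendsto_nhds_unique ((hc1.tendsto.mono_left nhdsWithin_le_nhds).congr' hne)
        (hg.continuousAt.tendsto.mono_left nhdsWithin_le_nhds)
    rw [eventually_nhdsWithin_iff] at hne
    filter_upwards [hne] with μ hμ
    by_cases h0 : μ = 0
    · rw [h0, h00]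
    · exact hμ h0
  induction n with
  | zero => exact ⟨g, hg, by simp⟩
  | succ n ih =>
    obtain ⟨k, hk, hkg⟩ := ih
    refine ⟨dslope k 0, hds k hk, ?_⟩
    have hcomp : ∀ μ, dslope (fun w => (S ^ n) (k w)) 0 μ = (S ^ n) (dslope k 0 μ) := fun μ =>
      ContinuousLinearMap.dslope_comp (S ^ n) k 0 μ fun _ => hk.differentiableAt
    -- Taking the slope of `Sⁿ k = g` gives `Sⁿ (dslope k) = dslope g`; one more `S` returns `g` by
    -- `key`.
    have heq : ∀ᶠ μ in 𝓝 (0 : ℂ), dslope (fun w => (S ^ n) (k w)) 0 μ = dslope g 0 μ := by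
      filter_upwards [hkg] with μ hμ
      by_cases h0 : μ = 0
      · rw [h0, dslope_same, dslope_same]
        exact Filter.EventuallyEq.deriv_eq hkg
      · rw [dslope_of_ne _ h0, dslope_of_ne _ h0, slope_def_module, slope_def_module, hμ,
          hkg.self_of_nhds]
    filter_upwards [heq, key] with μ h1 h2
    rw [pow_succ_apply', ← hcomp, h1, h2]

/-- Dividing a nonzero local solution by the power of `μ` given by its order of vanishing leaves a
local solution `g` with `g 0 ≠ 0`. Then `g 0` lies in `ker S ∩ ran Sⁿ`, which is zero once the
kernels have stabilized at `n`. -/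
theorem hasSVEPAt_zero_of_ascent_lt_top {S : Y →L[ℂ] Y} (hS : ascent S < ⊤) :
    HasSVEPAt S 0 := by
  obtain ⟨n, hn⟩ := (ascent_lt_top_iff S).1 hS
  intro U hU hUc h0 f hf hfU
  by_contra hne
  have hev : ¬ ∀ᶠ w in 𝓝 (0 : ℂ), f w = 0 := fun hz => hne fun μ hμ =>
    hf.eqOn_zero_of_preconnected_of_eventuallyEq_zero hUc h0 hz hμ
  obtain ⟨k, g, hg, hg0, hfg⟩ :=
    (hf 0 h0).exists_eventuallyEq_pow_smul_nonzero_iff.2 hev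
  have hne' : ∀ᶠ μ in 𝓝[≠] (0 : ℂ), S (g μ) = μ • g μ := by
    filter_upwards [mem_nhdsWithin_of_mem_nhds hfg,
      mem_nhdsWithin_of_mem_nhds (hU.mem_nhds h0), self_mem_nhdsWithin] with μ h1 h2 h3
    have h1 : f μ = (μ - 0) ^ k • g μ := h1
    have h3 : μ ≠ 0 := h3
    have h4 := hfU μ h2
    rw [h1, sub_zero, map_smul, smul_eq_zero_iff_right (pow_ne_zero k h3)] at h4
    simpa [sub_eq_zero] using h4
  have hcl : ContinuousAt (fun μ => S (g μ)) 0 := S.continuous.continuousAt.comp hg.continuousAt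
  have hcr : ContinuousAt (fun μ : ℂ => μ • g μ) 0 := continuousAt_id.smul hg.continuousAt
  have h00 : S (g 0) = (0 : ℂ) • g 0 :=
    tendsto_nhds_unique ((hcl.tendsto.mono_left nhdsWithin_le_nhds).congr' hne')
      (hcr.tendsto.mono_left nhdsWithin_le_nhds)
  have hall : ∀ᶠ μ in 𝓝 (0 : ℂ), S (g μ) = μ • g μ := by
    rw [eventually_nhdsWithin_iff] at hne'
    filter_upwards [hne'] with μ hμ
    by_cases h : μ = 0
    · rw [h, h00]
    · exact hμ h
  obtain ⟨a, -, ha⟩ := exists_analyticAt_pow_apply_eq hg hall n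
  refine hg0 (Submodule.disjoint_def.1 (disjoint_ker_range_pow hn) (g 0) ?_
    ⟨a 0, ha.self_of_nhds⟩)
  simpa using h00

/-- If `S` maps a closed subspace `R` onto itself and has a nonzero kernel in `R`, then `S` fails
the SVEP at `0`. -/
theorem HasSVEPAt.disjoint_ker_of_surjOn [CompleteSpace Y] {S : Y →L[ℂ] Y} (hS : HasSVEPAt S 0)
    {R : Submodule ℂ Y} (hR : IsClosed (R : Set Y)) (hmaps : ∀ x ∈ R, S x ∈ R)
    (hsurj : ∀ y ∈ R, ∃ x ∈ R, S x = y) : Disjoint S.ker R := by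
  rw [Submodule.disjoint_def]
  intro a ha haR
  have : CompleteSpace R := hR.completeSpace_coe
  obtain ⟨C, hC, hpre⟩ := ContinuousLinearMap.exists_preimage_norm_le (S.restrict hmaps) (by
    rintro ⟨y, hy⟩
    obtain ⟨x, hx, rfl⟩ := hsurj y hy
    exact ⟨⟨x, hx⟩, rfl⟩)
  choose r hr hrn using hpre
  -- A backward orbit of `a` growing at most like `Cⁿ`, by the open mapping theorem on `R`.
  let b : ℕ → R := fun n => r^[n] ⟨a, haR⟩
  have hb0 : (b 0 : Y) = a := rfl
  have hbs : ∀ n, S (b (n + 1)) = b n := fun n => by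
    have : b (n + 1) = r (b n) := Function.iterate_succ_apply' r n _
    rw [this]
    exact congrArg Subtype.val (hr (b n))
  have hbn : ∀ n, ‖(b n : Y)‖ ≤ C ^ n * ‖a‖ := fun n => by
    induction n with
    | zero => simp [hb0]
    | succ n ih =>
      have h1 : b (n + 1) = r (b n) := Function.iterate_succ_apply' r n _
      calc ‖(b (n + 1) : Y)‖ = ‖r (b n)‖ := by rw [h1]; rfl
        _ ≤ C * ‖(b n : Y)‖ := hrn (b n)
        _ ≤ C * (C ^ n * ‖a‖) := by gcongr
        _ = C ^ (n + 1) * ‖a‖ := by ring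
  set ρ : ℝ := 1 / (2 * C)
  have hρ : 0 < ρ := by positivity
  let F : ℕ → ℂ → Y := fun n w => w ^ n • (b n : Y)
  have hbound : ∀ n, ∀ w ∈ Metric.ball (0 : ℂ) ρ, ‖F n w‖ ≤ (1 / 2) ^ n * ‖a‖ := by
    intro n w hw
    have hw : ‖w‖ ≤ ρ := by simpa using (Metric.mem_ball.1 hw).le
    calc ‖F n w‖ = ‖w‖ ^ n * ‖(b n : Y)‖ := by simp [F, norm_smul]
      _ ≤ ρ ^ n * (C ^ n * ‖a‖) := by gcongr; exact hbn n
      _ = (ρ * C) ^ n * ‖a‖ := by ring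
      _ = (1 / 2) ^ n * ‖a‖ := by
        congr 2
        simp only [ρ]
        field_simp
  have hsum : Summable fun n : ℕ => (1 / 2 : ℝ) ^ n * ‖a‖ :=
    summable_geometric_two.mul_right _
  have hF : ∀ w ∈ Metric.ball (0 : ℂ) ρ, Summable fun n => F n w := fun w hw =>
    Summable.of_norm_bounded hsum fun n => hbound n w hw
  have hdiff : DifferentiableOn ℂ (fun w => ∑' n, F n w) (Metric.ball 0 ρ) :=
    Complex.differentiableOn_tsum_of_summable_norm hsum
      (fun n => ((differentiable_id.pow n).smul_const _).differentiableOn) Metric.isOpen_ball hbound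
  -- As `S (b 0) = 0` and `S (b (n + 1)) = b n`, the sum of `wⁿ b n` is a local solution; its value
  -- at `0` is `a`.
  have hzero := hS (Metric.ball 0 ρ) Metric.isOpen_ball (convex_ball 0 ρ).isPreconnected
    (Metric.mem_ball_self hρ) _ (hdiff.analyticOnNhd Metric.isOpen_ball) (fun w hw => by
      have h1 : S (∑' n, F n w) = ∑' n, S (F n w) := S.map_tsum (hF w hw)
      have h2 : Summable fun n => S (F n w) := S.summable (hF w hw)
      have h3 : ∀ n, S (F (n + 1) w) = w • F n w := fun n => by
        simp only [F, map_smul, hbs, smul_smul, pow_succ']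
      have h4 : S (F 0 w) = 0 := by
        simp only [F, pow_zero, one_smul]
        exact ha
      rw [sub_apply, h1, h2.tsum_eq_zero_add, h4, zero_add]
      simp only [h3]
      rw [(hF w hw).tsum_const_smul]
      simp) 0 (Metric.mem_ball_self hρ)
  rw [tsum_eq_single 0 (fun n hn => by simp [F, hn])] at hzero
  simpa [F, hb0] using hzero

end SVEP

/-! ### Closed ranges of powers of semi-Fredholm operators. -/

section ClosedRange

variable {Y : Type*} [NormedAddCommGroup Y] [NormedSpace ℂ Y]

/-- Onto its closed range `S` is a quotient map, and the preimage of `S p` is `p + ker S`, closed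
because the kernel is finite-dimensional. -/
theorem isClosed_map_of_finiteDimensional_ker [CompleteSpace Y] {S : Y →L[ℂ] Y}
    [FiniteDimensional ℂ S.ker] (hS : IsClosed (S.range : Set Y)) {p : Submodule ℂ Y}
    (hp : IsClosed (p : Set Y)) : IsClosed (S '' (p : Set Y)) := by
  have : CompleteSpace S.range := hS.completeSpace_coe
  have hsurj : Function.Surjective S.rangeRestrict := LinearMap.surjective_rangeRestrict S.toLinearMap
  have hq : IsQuotientMap S.rangeRestrict := S.rangeRestrict.isQuotientMap hsurj
  have hpre : S.rangeRestrict ⁻¹' (S.rangeRestrict '' (p : Set Y)) = (p ⊔ S.ker : Submodule ℂ Y) := by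
    ext x
    simp only [Set.mem_preimage, Set.mem_image, SetLike.mem_coe, Submodule.mem_sup]
    constructor
    · rintro ⟨y, hy, hxy⟩
      refine ⟨y, hy, x - y, ?_, by abel⟩
      have : S y = S x := congrArg Subtype.val hxy
      change S (x - y) = 0
      rw [map_sub, this, sub_self]
    · rintro ⟨y, hy, z, hz, rfl⟩
      have hz : S z = 0 := hz
      refine ⟨y, hy, Subtype.ext ?_⟩
      change S y = S (y + z)
      rw [map_add, hz, add_zero]
  have hc : IsClosed (S.rangeRestrict '' (p : Set Y)) := by
    rw [← hq.isClosed_preimage, hpre]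
    exact Submodule.isClosed_sup_finiteDimensional _ _ hp
  have := hS.isClosedEmbedding_subtypeVal.isClosedMap _ hc
  rw [← Set.image_comp] at this
  exact this

theorem range_pow_succ_eq_map (S : Y →L[ℂ] Y) (n : ℕ) :
    ((S ^ (n + 1)).range : Set Y) = S '' ((S ^ n).range : Set Y) := by
  ext y
  constructor
  · rintro ⟨x, rfl⟩
    exact ⟨_, ⟨x, rfl⟩, (pow_succ_apply' S n x).symm⟩
  · rintro ⟨_, ⟨x, rfl⟩, rfl⟩
    exact ⟨x, pow_succ_apply' S n x⟩

theorem IsUpperSemiFredholm.isClosed_range_pow [CompleteSpace Y] {S : Y →L[ℂ] Y}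
    (hS : IsUpperSemiFredholm S) (n : ℕ) : IsClosed ((S ^ n).range : Set Y) := by
  have := (nullity_lt_top_iff S).1 hS.1
  induction n with
  | zero =>
    have : ((S ^ 0).range : Set Y) = Set.univ := Set.eq_univ_of_forall fun x => ⟨x, by simp⟩
    rw [this]
    exact isClosed_univ
  | succ n ih =>
    rw [range_pow_succ_eq_map]
    exact isClosed_map_of_finiteDimensional_ker hS.2 ih

theorem finiteDimensional_quotient_iff {p : Submodule ℂ Y} :
    FiniteDimensional ℂ (Y ⧸ p) ↔ ∃ F : Submodule ℂ Y, F.FG ∧ F ⊔ p = ⊤ := by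
  constructor
  · intro h
    obtain ⟨F, hF⟩ := p.exists_isCompl
    exact ⟨F, Submodule.CoFG.fg_of_isCompl hF h, hF.symm.sup_eq_top⟩
  · rintro ⟨F, hF, hFp⟩
    refine ⟨?_⟩
    have := hF.map p.mkQ
    rwa [show F.map p.mkQ = ⊤ by
      rw [← Submodule.range_mkQ p, ← Submodule.map_top, ← hFp, Submodule.map_sup,
        Submodule.mkQ_map_self, sup_bot_eq]] at this

theorem finiteDimensional_quotient_range_pow {S : Y →L[ℂ] Y}
    (hS : FiniteDimensional ℂ (Y ⧸ S.range)) (n : ℕ) :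
    FiniteDimensional ℂ (Y ⧸ (S ^ n).range) := by
  rw [finiteDimensional_quotient_iff] at hS ⊢
  obtain ⟨F, hF, hFS⟩ := hS
  induction n with
  | zero =>
    refine ⟨⊥, Submodule.fg_bot, eq_top_iff.2 fun x _ => Submodule.mem_sup_right ⟨x, by simp⟩⟩
  | succ n ih =>
    obtain ⟨G, hG, hGS⟩ := ih
    refine ⟨F ⊔ G.map S.toLinearMap, hF.sup (hG.map _), eq_top_iff.2 fun x _ => ?_⟩
    obtain ⟨u, hu, _, ⟨y, rfl⟩, rfl⟩ := Submodule.mem_sup.1 (hFS ▸ Submodule.mem_top : x ∈ _)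
    obtain ⟨v, hv, _, ⟨w, rfl⟩, rfl⟩ := Submodule.mem_sup.1 (hGS ▸ Submodule.mem_top : y ∈ _)
    rw [map_add, ← add_assoc]
    refine Submodule.add_mem_sup (Submodule.add_mem_sup hu ⟨v, hv, rfl⟩)
      ⟨w, pow_succ_apply' S n w⟩

/-- Passing to `Y / ker S` makes the operator injective without changing its range, which has a
finite-dimensional, hence closed, complement. -/
theorem isClosed_range_of_finiteDimensional_quotient [CompleteSpace Y] (S : Y →L[ℂ] Y)
    [h : FiniteDimensional ℂ (Y ⧸ S.range)] : IsClosed (S.range : Set Y) := by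
  obtain ⟨F, hF⟩ := S.range.exists_isCompl
  have : FiniteDimensional ℂ F := .of_fg (Submodule.CoFG.fg_of_isCompl hF h)
  have hk : IsClosed (S.ker : Set Y) := S.isClosed_ker
  have hr : (S.ker.liftQL S le_rfl).range = S.range := Submodule.range_liftQ _ _ _
  rw [← hr] at hF ⊢
  exact ContinuousLinearMap.closed_complemented_range_of_isCompl_of_ker_eq_bot _ F hF
    F.closed_of_finiteDimensional (Submodule.ker_liftQ_eq_bot _ _ _ le_rfl)

theorem IsLowerSemiFredholm.isClosed_range_pow [CompleteSpace Y] {S : Y →L[ℂ] Y}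
    (hS : IsLowerSemiFredholm S) (n : ℕ) : IsClosed ((S ^ n).range : Set Y) := by
  have := finiteDimensional_quotient_range_pow ((deficiency_lt_top_iff S).1 hS) n
  exact isClosed_range_of_finiteDimensional_quotient _

end ClosedRange

/-! ### Uniform descent, and finite ascent from the SVEP. -/

section UniformDescent

variable {Y : Type*} [NormedAddCommGroup Y] [NormedSpace ℂ Y]

/-- Closed ranges of all powers, and `ker S ∩ ran Sⁿ` eventually constant. -/
structure HasTopologicalUniformDescent (S : Y →L[ℂ] Y) : Prop where
  isClosed_range_pow : ∀ n, IsClosed ((S ^ n).range : Set Y)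
  exists_ker_inf_range_pow_le : ∃ d, ∀ n ≥ d, S.ker ⊓ (S ^ n).range ≤ (S ^ (n + 1)).range

theorem IsUpperSemiFredholm.hasTopologicalUniformDescent [CompleteSpace Y] {S : Y →L[ℂ] Y}
    (hS : IsUpperSemiFredholm S) : HasTopologicalUniformDescent S := by
  refine ⟨hS.isClosed_range_pow, ?_⟩
  have := (nullity_lt_top_iff S).1 hS.1
  -- The spaces `ker S ∩ ran Sⁿ` form a decreasing chain in the finite-dimensional `ker S`.
  obtain ⟨d, hd⟩ := IsArtinian.monotone_stabilizes (R := ℂ) (M := S.ker)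
    ⟨fun n => OrderDual.toDual ((S ^ n).range.comap S.ker.subtype),
      fun m n hmn => Submodule.comap_mono (antitone_range_pow S hmn)⟩
  refine ⟨d, fun n hn x ⟨hx, hxn⟩ => ?_⟩
  have h1 : (S ^ n).range.comap S.ker.subtype = (S ^ (n + 1)).range.comap S.ker.subtype :=
    (hd n hn).symm.trans (hd (n + 1) (hn.trans n.le_succ))
  have h2 : (⟨x, hx⟩ : S.ker) ∈ (S ^ n).range.comap S.ker.subtype := hxn
  rw [h1] at h2
  exact h2

theorem IsLowerSemiFredholm.hasTopologicalUniformDescent [CompleteSpace Y] {S : Y →L[ℂ] Y}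
    (hS : IsLowerSemiFredholm S) : HasTopologicalUniformDescent S := by
  refine ⟨hS.isClosed_range_pow, ?_⟩
  have := (deficiency_lt_top_iff S).1 hS
  -- Here the kernel may be infinite-dimensional, so the increasing images of `ker Sⁿ` in `Y / ran
  -- S` are used instead.
  obtain ⟨d, hd⟩ := (monotone_stabilizes_iff_noetherian (R := ℂ) (M := Y ⧸ S.range)).2 inferInstance
    ⟨fun n => (S ^ n).ker.map S.range.mkQ,
      fun m n hmn => Submodule.map_mono (monotone_ker_pow S hmn)⟩
  refine ⟨d, fun n hn => (ker_inf_range_pow_le_succ_iff S n).2 ?_⟩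
  have h1 : (S ^ n).ker.map S.range.mkQ = (S ^ (n + 1)).ker.map S.range.mkQ :=
    (hd n hn).symm.trans (hd (n + 1) (hn.trans n.le_succ))
  have h2 := congrArg (Submodule.comap S.range.mkQ) h1
  rw [Submodule.comap_map_mkQ, Submodule.comap_map_mkQ] at h2
  rw [sup_comm, h2]
  exact le_sup_right

theorem IsSemiFredholm.hasTopologicalUniformDescent [CompleteSpace Y] {S : Y →L[ℂ] Y}
    (hS : IsSemiFredholm S) : HasTopologicalUniformDescent S :=
  hS.elim (·.hasTopologicalUniformDescent) (·.hasTopologicalUniformDescent)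

theorem HasTopologicalUniformDescent.ascent_lt_top [CompleteSpace Y] {S : Y →L[ℂ] Y}
    (h : HasTopologicalUniformDescent S) (hS : HasSVEPAt S 0) : ascent S < ⊤ := by
  obtain ⟨d, hd⟩ := h.exists_ker_inf_range_pow_le
  have hstab : ∀ n ≥ d, S.ker ⊓ (S ^ d).range ≤ (S ^ n).range := fun n hn => by
    induction n, hn using Nat.le_induction with
    | base => exact inf_le_right
    | succ n hn ih => exact (le_inf inf_le_left ih).trans (hd n hn)
  have hstab' : ∀ n, S.ker ⊓ (S ^ d).range ≤ (S ^ n).range := fun n =>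
    (hstab (max n d) (le_max_right _ _)).trans (antitone_range_pow S (le_max_left _ _))
  have hdisj := hS.disjoint_ker_of_surjOn (R := ⨅ n : ℕ, (S ^ n).range) (by
      rw [Submodule.coe_iInf]
      exact isClosed_iInter h.isClosed_range_pow)
    (fun x hx => by
      rw [Submodule.mem_iInf] at hx ⊢
      intro n
      obtain ⟨y, rfl⟩ := hx n
      exact range_pow_succ_le S n ⟨y, pow_succ_apply' S n y⟩)
    (fun y hy => by
      rw [Submodule.mem_iInf] at hy
      obtain ⟨a, rfl⟩ := hy (d + 1)
      -- The preimage `S^d a` is in every `ran Sⁿ`: if also `y = Sⁿ⁺¹ b` with `n ≥ d`, then `S^d a -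
      -- Sⁿ b` lies in `ker S ∩ ran S^d`, which is contained in all ranges.
      refine ⟨(S ^ d) a, ?_, (pow_succ_apply' S d a).symm⟩
      rw [Submodule.mem_iInf]
      suffices hge : ∀ n ≥ d, (S ^ d) a ∈ (S ^ n).range from fun n =>
        antitone_range_pow S (le_max_left n d) (hge _ (le_max_right n d))
      intro n hn
      obtain ⟨b, hb⟩ := hy (n + 1)
      have hb : (S ^ (n + 1)) b = (S ^ (d + 1)) a := hb
      have hmem : (S ^ d) a - (S ^ n) b ∈ S.ker ⊓ (S ^ d).range := by
        refine ⟨?_, sub_mem ⟨a, rfl⟩ (antitone_range_pow S hn ⟨b, rfl⟩)⟩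
        change S ((S ^ d) a - (S ^ n) b) = 0
        rw [map_sub, ← pow_succ_apply', ← pow_succ_apply', hb, sub_self]
      rw [← sub_add_cancel ((S ^ d) a) ((S ^ n) b)]
      exact add_mem (hstab' n hmem) ⟨b, rfl⟩)
  refine (ascent_lt_top_iff S).2 ⟨d, ker_pow_eq_succ_of_disjoint ?_⟩
  rw [Submodule.disjoint_def] at hdisj ⊢
  exact fun x hx hxd => hdisj x hx ((Submodule.mem_iInf _).2 fun n => hstab' n ⟨hx, hxd⟩)

end UniformDescent

/-! ### Duality between ascent and descent. -/

section Dual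

variable {Y : Type*} [NormedAddCommGroup Y] [NormedSpace ℂ Y]

@[simp]
theorem dualOp_apply_apply (S : Y →L[ℂ] Y) (φ : StrongDual ℂ Y) (y : Y) :
    dualOp S φ y = φ (S y) := rfl

theorem dualOp_pow_apply_apply (S : Y →L[ℂ] Y) (n : ℕ) (φ : StrongDual ℂ Y) (y : Y) :
    (dualOp S ^ n) φ y = φ ((S ^ n) y) := by
  induction n generalizing φ with
  | zero => rfl
  | succ n ih => rw [pow_succ_apply, ih, dualOp_apply_apply, ← pow_succ_apply']

theorem dualOp_pow (S : Y →L[ℂ] Y) (n : ℕ) : dualOp S ^ n = dualOp (S ^ n) := by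
  ext φ y
  exact dualOp_pow_apply_apply S n φ y

/-- A functional vanishing on the kernel of an operator with closed range factors through it. -/
theorem mem_range_dualOp_iff [CompleteSpace Y] {A : Y →L[ℂ] Y} (hA : IsClosed (A.range : Set Y))
    (φ : StrongDual ℂ Y) : φ ∈ (dualOp A).range ↔ ∀ x, A x = 0 → φ x = 0 := by
  constructor
  · rintro ⟨ψ, rfl⟩ x hx
    change ψ (A x) = 0
    rw [hx, map_zero]
  · intro h
    have : CompleteSpace A.range := hA.completeSpace_coe
    obtain ⟨C, hC, hpre⟩ := ContinuousLinearMap.exists_preimage_norm_le A.rangeRestrict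
      (LinearMap.surjective_rangeRestrict A.toLinearMap)
    choose r hr hrn using hpre
    have hr' : ∀ y : A.range, A (r y) = y := fun y => congrArg Subtype.val (hr y)
    have hwd : ∀ x x', A x = A x' → φ x = φ x' := fun x x' hx => by
      rw [← sub_eq_zero, ← map_sub]
      exact h _ (by rw [map_sub, hx, sub_self])
    -- The section `r` need not be linear; `φ ∘ r` is, because `φ` is constant on the fibres of `A`.
    let ψ₀ : A.range →ₗ[ℂ] ℂ :=
      { toFun := fun y => φ (r y)
        map_add' := fun y z => by
          rw [← map_add]
          exact hwd _ _ (by rw [map_add, hr', hr', hr']; rfl)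
        map_smul' := fun c y => by
          rw [RingHom.id_apply, ← map_smul]
          exact hwd _ _ (by rw [map_smul, hr', hr']; rfl) }
    let ψ : StrongDual ℂ A.range := ψ₀.mkContinuous (‖φ‖ * C) fun y =>
      calc ‖φ (r y)‖ ≤ ‖φ‖ * ‖r y‖ := φ.le_opNorm _
        _ ≤ ‖φ‖ * (C * ‖y‖) := by gcongr; exact hrn y
        _ = ‖φ‖ * C * ‖y‖ := by ring
    obtain ⟨g, hg, -⟩ := exists_extension_norm_eq A.range ψ
    refine ⟨g, ?_⟩
    ext x
    change g (A x) = φ x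
    have h1 := hg ⟨A x, x, rfl⟩
    refine h1.trans (hwd _ _ (hr' _))

theorem exists_dual_ne_zero_of_notMem {p : Submodule ℂ Y} (hp : IsClosed (p : Set Y)) {y : Y}
    (hy : y ∉ p) : ∃ φ : StrongDual ℂ Y, (∀ x ∈ p, φ x = 0) ∧ φ y ≠ 0 := by
  have hne : p.mkQ y ≠ 0 := by simpa using hy
  obtain ⟨f, hf⟩ := SeparatingDual.exists_ne_zero (R := ℂ) hne
  refine ⟨f.comp p.mkQL, fun x hx => ?_, hf⟩
  have : p.mkQ x = 0 := by simpa using hx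
  change f (p.mkQ x) = 0
  rw [this, map_zero]

/-- Closedness of `ran Sⁿ` makes `ran (S*)ⁿ` the annihilator of `ker Sⁿ`. Stabilization dualizes in
the form `ker Sⁿ⁺¹ ≤ ker Sⁿ + ran S`: a functional killing the right side kills the left. -/
theorem HasTopologicalUniformDescent.dualOp [CompleteSpace Y] {S : Y →L[ℂ] Y}
    (h : HasTopologicalUniformDescent S) : HasTopologicalUniformDescent (dualOp S) := by
  constructor
  · intro n
    rw [dualOp_pow]
    have : ((GzTheory.dualOp (S ^ n)).range : Set (StrongDual ℂ Y)) =
        ⋂ x : (S ^ n).ker, {φ : StrongDual ℂ Y | φ x = 0} := by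
      ext φ
      simp only [SetLike.mem_coe, mem_range_dualOp_iff (h.isClosed_range_pow n), Set.mem_iInter,
        Set.mem_ofPred_eq, Subtype.forall]
      rfl
    rw [this]
    exact isClosed_iInter fun x => isClosed_eq (by fun_prop) continuous_const
  · obtain ⟨d, hd⟩ := h.exists_ker_inf_range_pow_le
    refine ⟨d, fun n hn φ ⟨h1, h2⟩ => ?_⟩
    have hle := (ker_inf_range_pow_le_succ_iff S n).1 (hd n hn)
    rw [dualOp_pow] at h2 ⊢
    have h2 := (mem_range_dualOp_iff (h.isClosed_range_pow n) φ).1 h2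
    refine (mem_range_dualOp_iff (h.isClosed_range_pow _) φ).2 fun x hx => ?_
    obtain ⟨u, hu, _, ⟨y, rfl⟩, rfl⟩ := Submodule.mem_sup.1 (hle hx)
    have h3 : φ (S y) = 0 := congrArg (fun ψ : StrongDual ℂ Y => ψ y) h1
    rw [map_add, h2 u hu, zero_add]
    exact h3

theorem ascent_dualOp_lt_top {S : Y →L[ℂ] Y} (h : descent S < ⊤) : ascent (dualOp S) < ⊤ := by
  obtain ⟨n, hn⟩ := (descent_lt_top_iff S).1 h
  refine (ascent_lt_top_iff _).2 ⟨n, le_antisymm (ker_pow_le_succ _ n) fun φ hφ => ?_⟩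
  have hφ : (dualOp S ^ (n + 1)) φ = 0 := hφ
  change (dualOp S ^ n) φ = 0
  ext y
  have : (S ^ n) y ∈ (S ^ (n + 1)).range := hn ▸ ⟨y, rfl⟩
  obtain ⟨x, hx⟩ := this
  have hx : (S ^ (n + 1)) x = (S ^ n) y := hx
  rw [dualOp_pow_apply_apply, ← hx, ← dualOp_pow_apply_apply, hφ]
  rfl

/-- Finite ascent of `S*` says that functionals killing `ran Sⁿ⁺¹` kill `ran Sⁿ`; as `ran Sⁿ⁺¹` is
closed, Hahn–Banach gives equality. -/
theorem HasTopologicalUniformDescent.descent_lt_top [CompleteSpace Y] {S : Y →L[ℂ] Y}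
    (h : HasTopologicalUniformDescent S) (hS : HasSVEPAt (GzTheory.dualOp S) 0) :
    descent S < ⊤ := by
  obtain ⟨n, hn⟩ := (ascent_lt_top_iff _).1 (h.dualOp.ascent_lt_top hS)
  refine (descent_lt_top_iff S).2 ⟨n, le_antisymm ?_ (range_pow_succ_le S n)⟩
  rintro _ ⟨x, rfl⟩
  by_contra hx
  obtain ⟨φ, hφ, hφx⟩ := exists_dual_ne_zero_of_notMem (h.isClosed_range_pow (n + 1)) hx
  have h1 : φ ∈ (GzTheory.dualOp S ^ (n + 1)).ker := by
    change (GzTheory.dualOp S ^ (n + 1)) φ = 0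
    ext y
    rw [dualOp_pow_apply_apply]
    exact hφ _ ⟨y, rfl⟩
  rw [← hn] at h1
  have h1 : (GzTheory.dualOp S ^ n) φ = 0 := h1
  apply hφx
  change φ ((S ^ n) x) = 0
  rw [← dualOp_pow_apply_apply, h1]
  rfl

theorem hasSVEPAt_dualOp_zero_of_descent_lt_top {S : Y →L[ℂ] Y} (h : descent S < ⊤) :
    HasSVEPAt (dualOp S) 0 :=
  hasSVEPAt_zero_of_ascent_lt_top (ascent_dualOp_lt_top h)

end Dual

/-! ### Nullity, deficiency and the sign of the index. -/

section Index

variable {Y : Type*} [NormedAddCommGroup Y] [NormedSpace ℂ Y]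

theorem nullity_eq_finrank (S : Y →L[ℂ] Y) [FiniteDimensional ℂ S.ker] :
    nullity S = Module.finrank ℂ S.ker := by
  rw [nullity, ← Module.finrank_eq_rank, Cardinal.toENat_nat]

theorem deficiency_eq_finrank (S : Y →L[ℂ] Y) [FiniteDimensional ℂ (Y ⧸ S.range)] :
    deficiency S = Module.finrank ℂ (Y ⧸ S.range) := by
  rw [deficiency, ← Module.finrank_eq_rank, Cardinal.toENat_nat]

theorem finiteDimensional_ker_pow {S : Y →L[ℂ] Y} (hS : FiniteDimensional ℂ S.ker) (n : ℕ) :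
    FiniteDimensional ℂ (S ^ n).ker := by
  induction n with
  | zero =>
    have : (S ^ 0).ker = ⊥ := by
      rw [eq_bot_iff]
      intro x hx
      simpa using hx
    rw [this]
    infer_instance
  | succ n ih =>
    refine Module.Finite.iff_fg.2 (Submodule.fg_of_fg_map_of_fg_inf_ker S.toLinearMap ?_ ?_)
    · refine Submodule.FG.of_le (Module.Finite.iff_fg.1 ih) ?_
      rintro _ ⟨x, hx, rfl⟩
      have hx : (S ^ (n + 1)) x = 0 := hx
      rw [pow_succ_apply] at hx
      exact hx
    · exact Submodule.FG.of_le (Module.Finite.iff_fg.1 hS) inf_le_right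

/-- The map `K / S K → Y / ran S` induced by the inclusion of an invariant subspace `K`. -/
def cokerMap (S : Y →L[ℂ] Y) {K : Submodule ℂ Y} (hK : ∀ x ∈ K, S x ∈ K) :
    (K ⧸ (S.toLinearMap.restrict hK).range) →ₗ[ℂ] (Y ⧸ S.range) :=
  Submodule.mapQ _ _ K.subtype (by
    rintro _ ⟨x, rfl⟩
    exact ⟨x, rfl⟩)

theorem cokerMap_surjective_iff (S : Y →L[ℂ] Y) {K : Submodule ℂ Y} (hK : ∀ x ∈ K, S x ∈ K) :
    Function.Surjective (cokerMap S hK) ↔ K ⊔ S.range = ⊤ := by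
  rw [← LinearMap.range_eq_top, cokerMap, Submodule.range_mapQ, Submodule.range_subtype,
    ← (Submodule.comap_injective_of_surjective S.range.mkQ_surjective).eq_iff,
    Submodule.comap_map_mkQ, Submodule.comap_top, sup_comm]

theorem cokerMap_injective_iff (S : Y →L[ℂ] Y) {K : Submodule ℂ Y} (hK : ∀ x ∈ K, S x ∈ K) :
    Function.Injective (cokerMap S hK) ↔ ∀ y, S y ∈ K → ∃ k ∈ K, S k = S y := by
  rw [injective_iff_map_eq_zero]
  constructor
  · intro h y hy
    have h1 := h (Submodule.Quotient.mk ⟨S y, hy⟩) (by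
      rw [cokerMap, Submodule.mapQ_apply, Submodule.Quotient.mk_eq_zero]
      exact ⟨y, rfl⟩)
    rw [Submodule.Quotient.mk_eq_zero] at h1
    obtain ⟨k, hk⟩ := h1
    exact ⟨k, k.2, congrArg Subtype.val hk⟩
  · intro h q hq
    obtain ⟨⟨x, hx⟩, rfl⟩ := Submodule.Quotient.mk_surjective _ q
    rw [cokerMap, Submodule.mapQ_apply, Submodule.Quotient.mk_eq_zero] at hq
    obtain ⟨y, hy⟩ := hq
    have hy : S y = x := hy
    obtain ⟨k, hk, hky⟩ := h y (hy ▸ hx)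
    rw [Submodule.Quotient.mk_eq_zero]
    exact ⟨⟨k, hk⟩, Subtype.ext (hky.trans hy)⟩

/-- Rank–nullity on `K`. For `K = ker Sⁿ` it links the source of `cokerMap` to the nullity. -/
theorem finrank_quotient_range_restrict (S : Y →L[ℂ] Y) {K : Submodule ℂ Y}
    [FiniteDimensional ℂ K] (hK : ∀ x ∈ K, S x ∈ K) :
    Module.finrank ℂ (K ⧸ (S.toLinearMap.restrict hK).range) =
      Module.finrank ℂ (K ⊓ S.ker : Submodule ℂ Y) := by
  have h1 := (S.toLinearMap.restrict hK).finrank_range_add_finrank_ker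
  have h2 := (S.toLinearMap.restrict hK).range.finrank_quotient_add_finrank
  have h3 : (S.toLinearMap.restrict hK).ker = S.ker.comap K.subtype := by
    ext x
    exact Subtype.ext_iff
  have h4 : Module.finrank ℂ (S.ker.comap K.subtype) =
      Module.finrank ℂ (K ⊓ S.ker : Submodule ℂ Y) := by
    rw [← Submodule.map_comap_subtype]
    exact (Submodule.equivMapOfInjective _ K.subtype_injective _).finrank_eq
  rw [h3, h4] at h1
  omega

theorem apply_mem_ker_pow (S : Y →L[ℂ] Y) (n : ℕ) : ∀ x ∈ (S ^ n).ker, S x ∈ (S ^ n).ker := by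
  intro x hx
  have hx : (S ^ n) x = 0 := hx
  change (S ^ n) (S x) = 0
  rw [← pow_succ_apply, pow_succ_apply', hx, map_zero]

theorem ker_le_ker_pow {S : Y →L[ℂ] Y} {n : ℕ} (h : (S ^ n).ker = (S ^ (n + 1)).ker) :
    S.ker ≤ (S ^ n).ker := by
  rw [h]
  have := monotone_ker_pow S (Nat.le_add_left 1 n)
  simpa using this

theorem cokerMap_injective_of_ker_pow_eq {S : Y →L[ℂ] Y} {n : ℕ}
    (h : (S ^ n).ker = (S ^ (n + 1)).ker) :
    Function.Injective (cokerMap S (apply_mem_ker_pow S n)) := by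
  rw [cokerMap_injective_iff]
  intro y hy
  refine ⟨y, ?_, rfl⟩
  have hy : (S ^ n) (S y) = 0 := hy
  rw [← pow_succ_apply] at hy
  exact h ▸ hy

theorem finiteDimensional_ker_of_ascent {S : Y →L[ℂ] Y} {n : ℕ}
    (h : (S ^ n).ker = (S ^ (n + 1)).ker) (hS : FiniteDimensional ℂ (Y ⧸ S.range)) :
    FiniteDimensional ℂ S.ker := by
  have h1 := finiteDimensional_quotient_range_pow hS n
  exact Module.Finite.iff_fg.2 (Submodule.CoFG.fg_of_disjoint (disjoint_ker_range_pow h) h1)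

theorem finiteDimensional_quotient_range_of_descent {S : Y →L[ℂ] Y} {n : ℕ}
    (h : (S ^ n).range = (S ^ (n + 1)).range) (hS : FiniteDimensional ℂ S.ker) :
    FiniteDimensional ℂ (Y ⧸ S.range) :=
  finiteDimensional_quotient_iff.2
    ⟨_, Module.Finite.iff_fg.1 (finiteDimensional_ker_pow hS n), ker_pow_sup_range_eq_top h⟩

theorem nullity_le_deficiency_of_ascent_lt_top {S : Y →L[ℂ] Y} (h : ascent S < ⊤) :
    nullity S ≤ deficiency S := by
  by_cases hb : deficiency S < ⊤
  · obtain ⟨n, hn⟩ := (ascent_lt_top_iff S).1 h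
    have hd := (deficiency_lt_top_iff S).1 hb
    have hk := finiteDimensional_ker_of_ascent hn hd
    have := finiteDimensional_ker_pow hk n
    rw [nullity_eq_finrank, deficiency_eq_finrank, Nat.cast_le]
    have h1 := finrank_quotient_range_restrict S (apply_mem_ker_pow S n)
    rw [inf_eq_right.2 (ker_le_ker_pow hn)] at h1
    rw [← h1]
    exact LinearMap.finrank_le_finrank_of_injective (cokerMap_injective_of_ker_pow_eq hn)
  · rw [not_lt_top_iff.1 hb]
    exact le_top

theorem deficiency_le_nullity_of_descent_lt_top {S : Y →L[ℂ] Y} (h : descent S < ⊤) :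
    deficiency S ≤ nullity S := by
  by_cases ha : nullity S < ⊤
  · obtain ⟨n, hn⟩ := (descent_lt_top_iff S).1 h
    have hk := (nullity_lt_top_iff S).1 ha
    have hd := finiteDimensional_quotient_range_of_descent hn hk
    have := finiteDimensional_ker_pow hk n
    rw [nullity_eq_finrank, deficiency_eq_finrank, Nat.cast_le]
    calc Module.finrank ℂ (Y ⧸ S.range)
        ≤ Module.finrank ℂ (_ ⧸ (S.toLinearMap.restrict (apply_mem_ker_pow S n)).range) :=
          LinearMap.finrank_le_finrank_of_surjective
            ((cokerMap_surjective_iff S _).2 (ker_pow_sup_range_eq_top hn))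
      _ = _ := finrank_quotient_range_restrict S (apply_mem_ker_pow S n)
      _ ≤ _ := Submodule.finrank_mono inf_le_right
  · rw [not_lt_top_iff.1 ha]
    exact le_top

/-- For a Fredholm operator of index zero, finite ascent implies finite descent. -/
theorem descent_lt_top_of_ascent_lt_top {S : Y →L[ℂ] Y} (hS : deficiency S < ⊤)
    (hindex : nullity S = deficiency S) (h : ascent S < ⊤) : descent S < ⊤ := by
  obtain ⟨n, hn⟩ := (ascent_lt_top_iff S).1 h
  have hd := (deficiency_lt_top_iff S).1 hS
  have hk := finiteDimensional_ker_of_ascent hn hd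
  have := finiteDimensional_ker_pow hk n
  rw [nullity_eq_finrank, deficiency_eq_finrank, Nat.cast_inj] at hindex
  have h1 := finrank_quotient_range_restrict S (apply_mem_ker_pow S n)
  rw [inf_eq_right.2 (ker_le_ker_pow hn), hindex] at h1
  exact (descent_lt_top_iff S).2 ⟨n, range_pow_eq_succ_of_sup_eq_top
    ((cokerMap_surjective_iff S _).1
      ((LinearMap.injective_iff_surjective_of_finrank_eq_finrank h1).1
        (cokerMap_injective_of_ker_pow_eq hn)))⟩

/-- For a Fredholm operator of index zero, finite descent implies finite ascent. -/
theorem ascent_lt_top_of_descent_lt_top {S : Y →L[ℂ] Y} (hS : nullity S < ⊤)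
    (hindex : nullity S = deficiency S) (h : descent S < ⊤) : ascent S < ⊤ := by
  obtain ⟨n, hn⟩ := (descent_lt_top_iff S).1 h
  have hk := (nullity_lt_top_iff S).1 hS
  have hd := finiteDimensional_quotient_range_of_descent hn hk
  have := finiteDimensional_ker_pow hk n
  rw [nullity_eq_finrank, deficiency_eq_finrank, Nat.cast_inj] at hindex
  have hsurj := (cokerMap_surjective_iff S (apply_mem_ker_pow S n)).2 (ker_pow_sup_range_eq_top hn)
  have h1 := finrank_quotient_range_restrict S (apply_mem_ker_pow S n)
  have h2 := LinearMap.finrank_le_finrank_of_surjective hsurj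
  have h3 : Module.finrank ℂ ((S ^ n).ker ⊓ S.ker : Submodule ℂ Y) ≤ Module.finrank ℂ S.ker :=
    Submodule.finrank_mono inf_le_right
  -- With `K = ker Sⁿ`, the chain `β ≤ dim K / S K = dim (K ∩ ker S) ≤ α = β` consists of
  -- equalities.
  have hle : S.ker ≤ (S ^ n).ker := inf_eq_right.1
    (Submodule.eq_of_le_of_finrank_le inf_le_right (by omega))
  have hinj := (LinearMap.injective_iff_surjective_of_finrank_eq_finrank (by omega)).2 hsurj
  rw [cokerMap_injective_iff] at hinj
  refine (ascent_lt_top_iff S).2 ⟨n, le_antisymm (ker_pow_le_succ S n) fun x hx => ?_⟩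
  have hx : (S ^ (n + 1)) x = 0 := hx
  rw [pow_succ_apply] at hx
  obtain ⟨k, hk, hkx⟩ := hinj x hx
  rw [← sub_add_cancel x k]
  refine add_mem (hle ?_) hk
  change S (x - k) = 0
  rw [map_sub, hkx, sub_self]

theorem index_nonpos_iff (S : Y →L[ℂ] Y) : index S ≤ 0 ↔ nullity S ≤ deficiency S := by
  rw [index, EReal.sub_nonpos, EReal.coe_ennreal_le_coe_ennreal_iff, ENat.toENNReal_le]

/-- In `EReal`, `⊤ - ⊤ = ⊥`, so the equivalence fails if both dimensions are infinite; being
semi-Fredholm excludes this. -/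
theorem IsSemiFredholm.index_nonneg_iff {S : Y →L[ℂ] Y} (hS : IsSemiFredholm S) :
    0 ≤ index S ↔ deficiency S ≤ nullity S := by
  have h : ((((nullity S : ℕ∞) : ENNReal) : EReal) ≠ ⊤ ∨
      (((deficiency S : ℕ∞) : ENNReal) : EReal) ≠ ⊤) := by
    rcases hS with hS | hS
    · exact Or.inl (by simpa using hS.1.ne)
    · exact Or.inr (by simpa using LT.lt.ne hS)
  rw [index, EReal.sub_nonneg h (Or.inl (by simp)), EReal.coe_ennreal_le_coe_ennreal_iff,
    ENat.toENNReal_le]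

theorem IsSemiFredholm.index_eq_zero_iff {S : Y →L[ℂ] Y} (hS : IsSemiFredholm S) :
    index S = 0 ↔ nullity S = deficiency S := by
  rw [le_antisymm_iff, index_nonpos_iff, hS.index_nonneg_iff, ← le_antisymm_iff]

theorem IsSemiFredholm.isFredholm_of_index_eq_zero [CompleteSpace Y] {S : Y →L[ℂ] Y}
    (hS : IsSemiFredholm S) (h : index S = 0) : S.IsFredholm := by
  rw [hS.index_eq_zero_iff] at h
  rw [isFredholm_iff]
  rcases hS with hS | hS
  · exact ⟨hS, h.symm.trans_lt hS.1⟩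
  · refine ⟨⟨?_, ?_⟩, hS⟩
    · rw [h]
      exact hS
    · simpa using hS.isClosed_range_pow 1

theorem IsFredholm.isBrowder [CompleteSpace Y] {S : Y →L[ℂ] Y} (hS : S.IsFredholm)
    (h : HasSVEPAt S 0) (h' : HasSVEPAt (dualOp S) 0) : IsBrowder S := by
  have hd := ((isFredholm_iff S).1 hS).1.hasTopologicalUniformDescent
  exact ⟨hS, hd.ascent_lt_top h, hd.descent_lt_top h'⟩

end Index

/-! ### Transfer along `X = M ⊕ N`, and the implications for `T`. -/

section Reduction

variable {X : Type*} [NormedAddCommGroup X] [NormedSpace ℂ X]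

theorem Red.completeSpace_M [CompleteSpace X] {T : X →L[ℂ] X} (D : Red T) : CompleteSpace D.M :=
  D.isClosed_M.completeSpace_coe

theorem Red.isTopCompl [CompleteSpace X] {T : X →L[ℂ] X} (D : Red T) :
    Submodule.IsTopCompl D.M D.N :=
  Submodule.IsCompl.isTopCompl_of_isClosed D.isCompl D.isClosed_M D.isClosed_N

/-- The continuous projection onto `M` along `N`. -/
def Red.projM [CompleteSpace X] {T : X →L[ℂ] X} (D : Red T) : X →L[ℂ] D.M :=
  D.M.projectionOntoL D.N D.isTopCompl

/-- The continuous projection onto `N` along `M`. -/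
def Red.projN [CompleteSpace X] {T : X →L[ℂ] X} (D : Red T) : X →L[ℂ] D.N :=
  D.N.projectionOntoL D.M D.isTopCompl.symm

theorem Red.exists_add_eq {T : X →L[ℂ] X} (D : Red T) (x : X) :
    ∃ (m : D.M) (n : D.N), (m : X) + n = x := by
  obtain ⟨m, hm, n, hn, rfl⟩ :=
    Submodule.mem_sup.1 (D.isCompl.sup_eq_top ▸ Submodule.mem_top : x ∈ D.M ⊔ D.N)
  exact ⟨⟨m, hm⟩, ⟨n, hn⟩, rfl⟩

theorem Red.projM_add [CompleteSpace X] {T : X →L[ℂ] X} (D : Red T) (m : D.M) (n : D.N) :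
    D.projM (m + n) = m := by
  rw [map_add, Red.projM, Submodule.projectionOntoL_apply_left,
    Submodule.projectionOntoL_apply_right, add_zero]

theorem Red.projN_add [CompleteSpace X] {T : X →L[ℂ] X} (D : Red T) (m : D.M) (n : D.N) :
    D.projN (m + n) = n := by
  rw [map_add, Red.projN, Submodule.projectionOntoL_apply_left,
    Submodule.projectionOntoL_apply_right, zero_add]

theorem Red.apply_add {T : X →L[ℂ] X} (D : Red T) (m : D.M) (n : D.N) :
    T (m + n) = (D.onM m : X) + D.onN n := by
  rw [map_add]; rfl

theorem Red.projM_apply [CompleteSpace X] {T : X →L[ℂ] X} (D : Red T) (x : X) :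
    D.projM (T x) = D.onM (D.projM x) := by
  obtain ⟨m, n, rfl⟩ := D.exists_add_eq x
  rw [D.apply_add, D.projM_add, D.projM_add]

theorem Red.projN_apply [CompleteSpace X] {T : X →L[ℂ] X} (D : Red T) (x : X) :
    D.projN (T x) = D.onN (D.projN x) := by
  obtain ⟨m, n, rfl⟩ := D.exists_add_eq x
  rw [D.apply_add, D.projN_add, D.projN_add]

theorem Red.hasSVEPAt_onM {T : X →L[ℂ] X} (D : Red T) {z : ℂ} (h : HasSVEPAt T z) :
    HasSVEPAt D.onM z :=
  h.of_injective D.M.subtypeL Subtype.val_injective fun _ => rfl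

theorem Red.hasSVEPAt_dualOp_onM [CompleteSpace X] {T : X →L[ℂ] X} (D : Red T) {z : ℂ}
    (h : HasSVEPAt (dualOp T) z) : HasSVEPAt (dualOp D.onM) z := by
  refine h.of_injective (ContinuousLinearMap.precomp ℂ D.projM) (fun φ ψ hφψ => ?_) fun φ => ?_
  · ext m
    have := congrArg (fun χ : StrongDual ℂ X => χ ((m : X) + (0 : D.N))) hφψ
    change φ (D.projM _) = ψ (D.projM _) at this
    rwa [D.projM_add] at this
  · ext x
    change φ (D.onM (D.projM x)) = φ (D.projM (T x))
    rw [D.projM_apply]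

theorem Red.hasSVEPAt [CompleteSpace X] {T : X →L[ℂ] X} (D : Red T) {z : ℂ}
    (hM : HasSVEPAt D.onM z) (hN : HasSVEPAt D.onN z) : HasSVEPAt T z := by
  refine hM.of_jointly_injective hN D.projM D.projN D.projM_apply D.projN_apply fun x h1 h2 => ?_
  obtain ⟨m, n, rfl⟩ := D.exists_add_eq x
  rw [D.projM_add] at h1
  rw [D.projN_add] at h2
  rw [h1, h2]
  simp

theorem Red.hasSVEPAt_dualOp {T : X →L[ℂ] X} (D : Red T) {z : ℂ}
    (hM : HasSVEPAt (dualOp D.onM) z) (hN : HasSVEPAt (dualOp D.onN) z) :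
    HasSVEPAt (dualOp T) z := by
  refine hM.of_jointly_injective hN (ContinuousLinearMap.precomp ℂ D.M.subtypeL)
    (ContinuousLinearMap.precomp ℂ D.N.subtypeL) (fun _ => rfl) (fun _ => rfl)
    fun φ h1 h2 => ?_
  ext x
  obtain ⟨m, n, rfl⟩ := D.exists_add_eq x
  have h1 : φ m = 0 := congrArg (fun χ : StrongDual ℂ D.M => χ m) h1
  have h2 : φ n = 0 := congrArg (fun χ : StrongDual ℂ D.N => χ n) h2
  rw [map_add, h1, h2, add_zero]
  rfl

theorem exists_gzIndex_eq {T : X →L[ℂ] X}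
    (h : ∃ D : Red T, IsSemiFredholm D.onM ∧ IsZeroloid D.onN) :
    ∃ D : Red T, IsSemiFredholm D.onM ∧ IsZeroloid D.onN ∧ gzIndex T = index D.onM :=
  ⟨h.choose, h.choose_spec.1, h.choose_spec.2, by rw [gzIndex, dif_pos h]⟩

/-- The SVEP of `T` descends to the first summand of whichever pair `gzIndex` selects, and finite
ascent there fixes the sign. -/
theorem gzIndex_nonpos [CompleteSpace X] {T : X →L[ℂ] X}
    (h : ∃ D : Red T, IsSemiFredholm D.onM ∧ IsZeroloid D.onN) (hT : HasSVEPAt T 0) :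
    gzIndex T ≤ 0 := by
  obtain ⟨D, hD, -, hind⟩ := exists_gzIndex_eq h
  have := D.completeSpace_M
  rw [hind, index_nonpos_iff]
  exact nullity_le_deficiency_of_ascent_lt_top
    (hD.hasTopologicalUniformDescent.ascent_lt_top (D.hasSVEPAt_onM hT))

theorem gzIndex_nonneg [CompleteSpace X] {T : X →L[ℂ] X}
    (h : ∃ D : Red T, IsSemiFredholm D.onM ∧ IsZeroloid D.onN) (hT : HasSVEPAt (dualOp T) 0) :
    0 ≤ gzIndex T := by
  obtain ⟨D, hD, -, hind⟩ := exists_gzIndex_eq h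
  have := D.completeSpace_M
  rw [hind, hD.index_nonneg_iff]
  exact deficiency_le_nullity_of_descent_lt_top
    (hD.hasTopologicalUniformDescent.descent_lt_top (D.hasSVEPAt_dualOp_onM hT))

variable {T : X →L[ℂ] X}

theorem IsLowerSemiGzBrowder.hasSVEPAt_dualOp (h : IsLowerSemiGzBrowder T) :
    HasSVEPAt (dualOp T) 0 := by
  obtain ⟨D, hM, hN⟩ := h
  exact D.hasSVEPAt_dualOp (hasSVEPAt_dualOp_zero_of_descent_lt_top hM.2) hN.hasSVEPAt_dualOp

variable [CompleteSpace X]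

theorem IsUpperSemiGzBrowder.hasSVEPAt (h : IsUpperSemiGzBrowder T) : HasSVEPAt T 0 := by
  obtain ⟨D, hM, hN⟩ := h
  exact D.hasSVEPAt (hasSVEPAt_zero_of_ascent_lt_top hM.2) hN.hasSVEPAt

theorem IsGzBrowder.isUpperSemiGzBrowder (h : IsGzBrowder T) : IsUpperSemiGzBrowder T := by
  obtain ⟨D, hM, hN⟩ := h
  have := D.completeSpace_M
  exact ⟨D, ⟨((isFredholm_iff _).1 hM.1).1, hM.2.1⟩, hN⟩

theorem IsGzBrowder.isLowerSemiGzBrowder (h : IsGzBrowder T) : IsLowerSemiGzBrowder T := by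
  obtain ⟨D, hM, hN⟩ := h
  have := D.completeSpace_M
  exact ⟨D, ⟨((isFredholm_iff _).1 hM.1).2, hM.2.2⟩, hN⟩

theorem IsUpperSemiGzBrowder.isUpperSemiGzWeyl (h : IsUpperSemiGzBrowder T) :
    IsUpperSemiGzWeyl T := by
  have hT := h.hasSVEPAt
  obtain ⟨D, hM, hN⟩ := h
  exact ⟨⟨D, hM.1, hN⟩, gzIndex_nonpos ⟨D, Or.inl hM.1, hN⟩ hT⟩

theorem IsLowerSemiGzBrowder.isLowerSemiGzWeyl (h : IsLowerSemiGzBrowder T) :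
    IsLowerSemiGzWeyl T := by
  have hT := h.hasSVEPAt_dualOp
  obtain ⟨D, hM, hN⟩ := h
  exact ⟨⟨D, hM.1, hN⟩, gzIndex_nonneg ⟨D, Or.inr hM.1, hN⟩ hT⟩

theorem IsGzBrowder.isGzWeyl (h : IsGzBrowder T) : IsGzWeyl T := by
  refine ⟨?_, le_antisymm h.isUpperSemiGzBrowder.isUpperSemiGzWeyl.2
    h.isLowerSemiGzBrowder.isLowerSemiGzWeyl.2⟩
  obtain ⟨D, hM, hN⟩ := h
  exact ⟨D, hM.1, hN⟩

theorem IsUpperSemiGzFredholm.isUpperSemiGzBrowder (h : IsUpperSemiGzFredholm T)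
    (hT : HasSVEPAt T 0) : IsUpperSemiGzBrowder T := by
  obtain ⟨D, hM, hN⟩ := h
  have := D.completeSpace_M
  exact ⟨D, ⟨hM, hM.hasTopologicalUniformDescent.ascent_lt_top (D.hasSVEPAt_onM hT)⟩, hN⟩

theorem IsLowerSemiGzFredholm.isLowerSemiGzBrowder (h : IsLowerSemiGzFredholm T)
    (hT : HasSVEPAt (dualOp T) 0) : IsLowerSemiGzBrowder T := by
  obtain ⟨D, hM, hN⟩ := h
  have := D.completeSpace_M
  exact ⟨D, ⟨hM, hM.hasTopologicalUniformDescent.descent_lt_top (D.hasSVEPAt_dualOp_onM hT)⟩, hN⟩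

theorem IsGzFredholm.isGzBrowder (h : IsGzFredholm T) (hT : HasSVEPAt T 0)
    (hT' : HasSVEPAt (dualOp T) 0) : IsGzBrowder T := by
  obtain ⟨D, hM, hN⟩ := h
  have := D.completeSpace_M
  exact ⟨D, IsFredholm.isBrowder hM (D.hasSVEPAt_onM hT) (D.hasSVEPAt_dualOp_onM hT'), hN⟩

theorem IsGzWeyl.isGzBrowder (h : IsGzWeyl T) (hT : HasSVEPAt T 0 ∨ HasSVEPAt (dualOp T) 0) :
    IsGzBrowder T := by
  obtain ⟨⟨D₀, hM₀, hN₀⟩, hindex⟩ := h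
  have := D₀.completeSpace_M
  -- The index is known to vanish only for the pair selected by `gzIndex`, so `D` replaces `D₀`;
  -- index zero upgrades semi-Fredholm to Fredholm on it.
  obtain ⟨D, hD, hN, hind⟩ :=
    exists_gzIndex_eq ⟨D₀, Or.inl ((isFredholm_iff _).1 hM₀).1, hN₀⟩
  have := D.completeSpace_M
  rw [hind] at hindex
  have hF := hD.isFredholm_of_index_eq_zero hindex
  have heq := hD.index_eq_zero_iff.1 hindex
  obtain ⟨hU, hL⟩ := (isFredholm_iff _).1 hF
  refine ⟨D, ?_, hN⟩
  rcases hT with hT | hT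
  · have hp := hU.hasTopologicalUniformDescent.ascent_lt_top (D.hasSVEPAt_onM hT)
    exact ⟨hF, hp, descent_lt_top_of_ascent_lt_top hL heq hp⟩
  · have hq := hU.hasTopologicalUniformDescent.descent_lt_top (D.hasSVEPAt_dualOp_onM hT)
    exact ⟨hF, ascent_lt_top_of_descent_lt_top hU.1 heq hq, hq⟩

end Reduction

end GzTheory

end

theorem proposition3p10 {X : Type*} [NormedAddCommGroup X] [NormedSpace ℂ X] [CompleteSpace X]
    (T : X →L[ℂ] X) :
    [GzTheory.IsUpperSemiGzBrowder T,
      GzTheory.IsUpperSemiGzWeyl T ∧ GzTheory.HasSVEPAt T 0,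
      GzTheory.IsUpperSemiGzFredholm T ∧ GzTheory.HasSVEPAt T 0].TFAE ∧
    [GzTheory.IsLowerSemiGzBrowder T,
      GzTheory.IsLowerSemiGzWeyl T ∧ GzTheory.HasSVEPAt (GzTheory.dualOp T) 0,
      GzTheory.IsLowerSemiGzFredholm T ∧ GzTheory.HasSVEPAt (GzTheory.dualOp T) 0].TFAE ∧
    [GzTheory.IsGzBrowder T,
      GzTheory.IsGzWeyl T ∧
        (GzTheory.HasSVEPAt T 0 ∨ GzTheory.HasSVEPAt (GzTheory.dualOp T) 0),
      GzTheory.IsGzFredholm T ∧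
        GzTheory.HasSVEPAt (T.prodMap (GzTheory.dualOp T)) 0].TFAE := by
  refine ⟨?_, ?_, ?_⟩
  · tfae_have 1 → 2 := fun h => ⟨h.isUpperSemiGzWeyl, h.hasSVEPAt⟩
    tfae_have 2 → 3 := fun h => ⟨h.1.1, h.2⟩
    tfae_have 3 → 1 := fun h => h.1.isUpperSemiGzBrowder h.2
    tfae_finish
  · tfae_have 1 → 2 := fun h => ⟨h.isLowerSemiGzWeyl, h.hasSVEPAt_dualOp⟩
    tfae_have 2 → 3 := fun h => ⟨h.1.1, h.2⟩
    tfae_have 3 → 1 := fun h => h.1.isLowerSemiGzBrowder h.2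
    tfae_finish
  · tfae_have 1 → 2 := fun h => ⟨h.isGzWeyl, Or.inl h.isUpperSemiGzBrowder.hasSVEPAt⟩
    tfae_have 2 → 1 := fun h => h.1.isGzBrowder h.2
    tfae_have 1 → 3 := fun h => ⟨h.isGzWeyl.1, GzTheory.hasSVEPAt_prodMap_iff.2
      ⟨h.isUpperSemiGzBrowder.hasSVEPAt, h.isLowerSemiGzBrowder.hasSVEPAt_dualOp⟩⟩
    tfae_have 3 → 1 := fun h => by
      obtain ⟨h1, h2⟩ := GzTheory.hasSVEPAt_prodMap_iff.1 h.2
      exact h.1.isGzBrowder h1 h2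
    tfae_finish
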